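/- Let $n\ge 2$ and let $R\in\mathbb R^{n\times n}$ be a demand matrix, i.e. $R_{ij}\ge 0$ and $\sum_{i,j}R_{ij}=1$. Let $\vec p=(p_1,\dots,p_n)$ be whichever of the two marginals $\vec p_s=R\mathbf 1$ and $\vec p_d=R^{\top}\mathbf 1$ has the smaller entropy $H(\vec p)=\sum_i p_i\log_2(1/p_i)$ (either one in case of a tie), and assume $p_i>0$ for all $i$. Put $F_i=\sum_{j\le i}p_j$, $p_{\min}=\min_i p_i$ and $p_S=\sum_{u_i\in S}p_i$ for a set $S$ of nodes. For a shift $U\in[0,1)$ let $G=G(\vec p,U)$ be the following simple undirected graph on the nodes $V=\{u_1,\dots,u_n\}$. Node $u_i$ owns the segment $s_i=[U+F_{i-1},\,U+F_i)\bmod 1$ of the cyclic space $[0,1)$. Two distinct nodes $u_i,u_j$ are adjacent if there are $y,z$, one in $s_i$ and the other in $s_j$, with $z\in\{\,y/2,\ (y+1)/2,\ 2y \bmod 1\,\}$, or if they are consecutive on the ring $u_1,u_2,\dots,u_n,u_1$. For $S\subseteq V$ let $C(S,\bar S)$ be the set of edges of $G$ between $S$ and $\bar S=V\setminus S$. Then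 there is an absolute constant $c>0$ such that for all $n$, $R$ and $\vec p$ as above and every $S\subseteq V$ with $p_S\le 1/2$, $$\mathbb E_{U}\bigl[\,|C(S,\bar S)|\,\bigr]\ \ge\ c\cdot\frac{n\,p_S}{\log_2(1/p_{\min})},$$ where $U$ is uniformly distributed on $[0,1)$. -/

import Mathlib

open MeasureTheory

namespace CACD

/-- A demand matrix: `R i j` is the probability of a request from node `i` to node `j`. -/
structure IsDemandMatrix {n : ℕ} (R : Matrix (Fin n) (Fin n) ℝ) : Prop where
  nonneg : ∀ i j, 0 ≤ R i j
  sum_eq_one : ∑ i, ∑ j, R i j = 1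

/-- The source marginal `R 1`. -/
def source {n : ℕ} (R : Matrix (Fin n) (Fin n) ℝ) : Fin n → ℝ :=
  fun i => ∑ j, R i j

/-- The destination marginal `1ᵀ R`. -/
def dest {n : ℕ} (R : Matrix (Fin n) (Fin n) ℝ) : Fin n → ℝ :=
  fun j => ∑ i, R i j

/-- The binary entropy (in Lean `0 * logb 2 (1 / 0) = 0`, which is the usual convention). -/
noncomputable def entropy {n : ℕ} (p : Fin n → ℝ) : ℝ :=
  ∑ i, p i * Real.logb 2 (1 / p i)

/-- `p` is the marginal of `R` of smaller entropy (either of the two in case of a tie). -/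
def IsActivity {n : ℕ} (R : Matrix (Fin n) (Fin n) ℝ) (p : Fin n → ℝ) : Prop :=
  (p = source R ∧ entropy (source R) ≤ entropy (dest R)) ∨
    (p = dest R ∧ entropy (dest R) ≤ entropy (source R))

/-- The sum of `p j` over all `j` strictly before `i`: the left end point of the unshifted
segment of node `i`. The right end point is `cdfBefore p i + p i`. -/
def cdfBefore {n : ℕ} (p : Fin n → ℝ) (i : Fin n) : ℝ :=
  ∑ j ∈ Finset.univ.filter (fun j => j < i), p j

/-- The segment of node `i` in the cyclic space `[0, 1)` when the shift is `U`: the image modulo 1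
of the half-open interval from `U + cdfBefore p i` to `U + cdfBefore p i + p i`. -/
def segment {n : ℕ} (p : Fin n → ℝ) (U : ℝ) (i : Fin n) : Set ℝ :=
  Int.fract '' Set.Ico (U + cdfBefore p i) (U + cdfBefore p i + p i)

/-- The left, right and backward edges of the continuous graph on `[0, 1)`. -/
def ContEdge (y z : ℝ) : Prop :=
  z = y / 2 ∨ z = (y + 1) / 2 ∨ z = Int.fract (2 * y)

/-- The discrete network for the shift `U`: two distinct nodes are joined if some edge of the
continuous graph runs between their segments, or if they are consecutive on the ring. -/
def network {n : ℕ} (p : Fin n → ℝ) (U : ℝ) : SimpleGraph (Fin n) :=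
  SimpleGraph.fromRel fun i j =>
    (∃ y ∈ segment p U i, ∃ z ∈ segment p U j, ContEdge y z) ∨
      (j : ℕ) = ((i : ℕ) + 1) % n

/-- The edges between `S` and its complement, each one written with its end point in `S` first. -/
def cut {V : Type*} (G : SimpleGraph V) (S : Finset V) : Set (V × V) :=
  {e | e.1 ∈ S ∧ e.2 ∉ S ∧ G.Adj e.1 e.2}

/-- The expected number of cut edges when the shift is uniform on `[0, 1)`. -/
noncomputable def expectedCut {n : ℕ} (p : Fin n → ℝ) (S : Finset (Fin n)) : ℝ :=
  ∫ U in Set.Ico (0 : ℝ) 1, ((cut (network p U) S).ncard : ℝ)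

/-- The length of the shortest segment. -/
noncomputable def pMin {n : ℕ} (p : Fin n → ℝ) : ℝ := ⨅ i, p i

end CACD

namespace CACD

/-! Measure positions relative to the shift: the left end point of segment `i` is `U + cdfBefore p
i`, so its double lies at `U + 2 * cdfBefore p i` modulo 1, which is uniform on `[0, 1)`. It
therefore hits segment `j` with probability `p j`, and adjacency of distinct `i`, `j` has
probability at least `p j`, hence by symmetry also at least `p i` (`le_adjProb`). Summing over `S ×
Sᶜ` bounds the expected cut below by both `|S| * p(Sᶜ) ≥ |S| * p(S)` and `|Sᶜ| * p(S)`; adding the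
two gives `n * p(S) / 2`. This is stronger than required, because the logarithm is at least 1. -/

/-- Some doubling edge of the continuous graph runs from the segment of `i` to that of `j`. -/
def DoublingEdge {n : ℕ} (p : Fin n → ℝ) (U : ℝ) (i j : Fin n) : Prop :=
  ∃ y ∈ segment p U i, ∃ z ∈ segment p U j, z = Int.fract (2 * y)

lemma fract_two_mul_fract (x : ℝ) : Int.fract (2 * Int.fract x) = Int.fract (2 * x) := by
  rw [Int.fract_eq_fract]
  exact ⟨-(2 * ⌊x⌋), by rw [Int.fract]; push_cast; ring⟩

/-- The halving maps are the two inverse branches of doubling modulo 1, so only doubling, in either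
direction, has to be studied. -/
lemma contEdge_iff {y z : ℝ} (hy : y ∈ Set.Ico (0 : ℝ) 1) (hz : z ∈ Set.Ico (0 : ℝ) 1) :
    ContEdge y z ↔ z = Int.fract (2 * y) ∨ y = Int.fract (2 * z) := by
  obtain ⟨hy0, hy1⟩ := hy
  obtain ⟨hz0, hz1⟩ := hz
  constructor
  · rintro (h | h | h)
    · right
      rw [h, show 2 * (y / 2) = y by ring, Int.fract_eq_self.2 ⟨hy0, hy1⟩]
    · right
      rw [h, show 2 * ((y + 1) / 2) = y + 1 by ring, Int.fract_add_one,
        Int.fract_eq_self.2 ⟨hy0, hy1⟩]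
    · exact Or.inl h
  · rintro (h | h)
    · exact Or.inr (Or.inr h)
    · rcases lt_or_ge z (1 / 2) with hlt | hge
      · left
        rw [Int.fract_eq_self.2 ⟨by linarith, by linarith⟩] at h
        linarith
      · right; left
        rw [← Int.fract_sub_one, Int.fract_eq_self.2 ⟨by linarith, by linarith⟩] at h
        linarith

lemma segment_subset_Ico {n : ℕ} (p : Fin n → ℝ) (U : ℝ) (i : Fin n) :
    segment p U i ⊆ Set.Ico 0 1 := by
  rintro _ ⟨x, -, rfl⟩
  exact ⟨Int.fract_nonneg x, Int.fract_lt_one x⟩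

lemma exists_contEdge_iff {n : ℕ} (p : Fin n → ℝ) (U : ℝ) (i j : Fin n) :
    (∃ y ∈ segment p U i, ∃ z ∈ segment p U j, ContEdge y z) ↔
      DoublingEdge p U i j ∨ DoublingEdge p U j i := by
  constructor
  · rintro ⟨y, hy, z, hz, h⟩
    rcases (contEdge_iff (segment_subset_Ico p U i hy) (segment_subset_Ico p U j hz)).1 h with h | h
    · exact Or.inl ⟨y, hy, z, hz, h⟩
    · exact Or.inr ⟨z, hz, y, hy, h⟩
  · rintro (⟨y, hy, z, hz, h⟩ | ⟨z, hz, y, hy, h⟩)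
    · exact ⟨y, hy, z, hz, Or.inr (Or.inr h)⟩
    · exact ⟨y, hy, z, hz,
        (contEdge_iff (segment_subset_Ico p U i hy) (segment_subset_Ico p U j hz)).2 (Or.inr h)⟩

lemma network_adj_iff {n : ℕ} (p : Fin n → ℝ) (U : ℝ) (i j : Fin n) :
    (network p U).Adj i j ↔ i ≠ j ∧ (DoublingEdge p U i j ∨ DoublingEdge p U j i ∨
      (j : ℕ) = ((i : ℕ) + 1) % n ∨ (i : ℕ) = ((j : ℕ) + 1) % n) := by
  rw [network, SimpleGraph.fromRel_adj, exists_contEdge_iff, exists_contEdge_iff]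
  tauto

/-- Substituting `U + a` and `U + b` into `z ≡ 2y` leaves a single `U`, with coefficient 1; this is
what makes both measurability and the probability accessible. -/
lemma doublingEdge_iff {n : ℕ} (p : Fin n → ℝ) (U : ℝ) (i j : Fin n) :
    DoublingEdge p U i j ↔
      ∃ k : ℤ, ∃ a ∈ Set.Ico (cdfBefore p i) (cdfBefore p i + p i),
        ∃ b ∈ Set.Ico (cdfBefore p j) (cdfBefore p j + p j), U = b - 2 * a + k := by
  constructor
  · rintro ⟨_, ⟨x, hx, rfl⟩, _, ⟨w, hw, rfl⟩, h⟩
    rw [fract_two_mul_fract, eq_comm, Int.fract_eq_fract] at h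
    obtain ⟨k, hk⟩ := h
    refine ⟨k, x - U, ⟨by linarith [hx.1], by linarith [hx.2]⟩,
      w - U, ⟨by linarith [hw.1], by linarith [hw.2]⟩, ?_⟩
    rw [← hk]; ring
  · rintro ⟨k, a, ha, b, hb, h⟩
    refine ⟨_, ⟨U + a, ⟨by linarith [ha.1], by linarith [ha.2]⟩, rfl⟩,
      _, ⟨U + b, ⟨by linarith [hb.1], by linarith [hb.2]⟩, rfl⟩, ?_⟩
    rw [fract_two_mul_fract, eq_comm, Int.fract_eq_fract]
    exact ⟨k, by linarith⟩

lemma measurableSet_doublingEdge {n : ℕ} (p : Fin n → ℝ) (i j : Fin n) :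
    MeasurableSet {U | DoublingEdge p U i j} := by
  simp only [doublingEdge_iff, Set.ofPred_exists]
  refine MeasurableSet.iUnion fun k => ?_
  -- For fixed `k` the admissible shifts are the image of a product of intervals under an affine
  -- map, hence convex in `ℝ`.
  refine Set.OrdConnected.measurableSet (Convex.ordConnected ?_)
  rintro x hx y hy s t hs ht hst
  simp only [Set.mem_iUnion, Set.mem_ofPred_eq] at hx hy ⊢
  obtain ⟨a, ha, b, hb, rfl⟩ := hx
  obtain ⟨a', ha', b', hb', rfl⟩ := hy
  refine ⟨s • a + t • a', convex_Ico _ _ ha ha' hs ht hst,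
    s • b + t • b', convex_Ico _ _ hb hb' hs ht hst, ?_⟩
  simp only [smul_eq_mul]
  linear_combination (k : ℝ) * hst

lemma measurableSet_network_adj {n : ℕ} (p : Fin n → ℝ) (i j : Fin n) :
    MeasurableSet {U | (network p U).Adj i j} := by
  simp only [network_adj_iff]
  exact (MeasurableSet.const _).inter ((measurableSet_doublingEdge p i j).union
    ((measurableSet_doublingEdge p j i).union (MeasurableSet.const _)))

/-- The doubling image of the left end point of segment `i` reaches segment `j`. -/
lemma doublingEdge_of_fract_mem {n : ℕ} {p : Fin n → ℝ} {U : ℝ} {i j : Fin n} (hi : 0 < p i)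
    (h : Int.fract (U + 2 * cdfBefore p i) ∈ Set.Ico (cdfBefore p j) (cdfBefore p j + p j)) :
    DoublingEdge p U i j :=
  (doublingEdge_iff p U i j).2 ⟨⌊U + 2 * cdfBefore p i⌋, cdfBefore p i, ⟨le_rfl, by linarith⟩, _, h,
    by rw [Int.fract]; ring⟩

/-- Translation invariance of the uniform law on the circle, via periodicity of `Int.fract`. -/
lemma setIntegral_indicator_fract_add {a b : ℝ} (ha : 0 ≤ a) (hab : a ≤ b) (hb : b ≤ 1) (t : ℝ) :
    ∫ U in Set.Ico (0 : ℝ) 1, (Set.Ico a b).indicator (fun _ => (1 : ℝ)) (Int.fract (U + t)) =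
      b - a := by
  set f : ℝ → ℝ := fun x => (Set.Ico a b).indicator (fun _ => (1 : ℝ)) (Int.fract x) with hf
  have hper : Function.Periodic f 1 := fun x => by simp [hf]
  calc ∫ U in Set.Ico (0 : ℝ) 1, f (U + t)
      = ∫ U in (0 : ℝ)..1, f (U + t) := by
        rw [intervalIntegral.integral_of_le zero_le_one, integral_Ico_eq_integral_Ioc]
    _ = ∫ x in t..t + 1, f x := by
        rw [intervalIntegral.integral_comp_add_right, zero_add, add_comm 1 t]
    _ = ∫ x in (0 : ℝ)..0 + 1, f x := hper.intervalIntegral_add_eq t 0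
    _ = ∫ x in Set.Ico (0 : ℝ) 1, f x := by
        rw [zero_add, intervalIntegral.integral_of_le zero_le_one, integral_Ico_eq_integral_Ioc]
    _ = ∫ x in Set.Ico (0 : ℝ) 1, (Set.Ico a b).indicator (fun _ => (1 : ℝ)) x :=
        setIntegral_congr_fun measurableSet_Ico fun x hx => by
          simp only [hf]; rw [Int.fract_eq_self.2 ⟨hx.1, hx.2⟩]
    _ = b - a := by
        rw [setIntegral_indicator measurableSet_Ico,
          Set.inter_eq_right.2 (Set.Ico_subset_Ico ha hb)]
        simp [hab]

lemma cdfBefore_nonneg {n : ℕ} {p : Fin n → ℝ} (hp : ∀ i, 0 < p i) (i : Fin n) :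
    0 ≤ cdfBefore p i :=
  Finset.sum_nonneg fun j _ => (hp j).le

lemma cdfBefore_add_le_sum {n : ℕ} {p : Fin n → ℝ} (hp : ∀ i, 0 < p i) (i : Fin n) :
    cdfBefore p i + p i ≤ ∑ j, p j := by
  rw [cdfBefore, add_comm, ← Finset.sum_insert (by simp)]
  exact Finset.sum_le_sum_of_subset_of_nonneg (Finset.subset_univ _) fun j _ _ => (hp j).le

/-- The probability that `i` and `j` are adjacent. -/
noncomputable def adjProb {n : ℕ} (p : Fin n → ℝ) (i j : Fin n) : ℝ :=
  ∫ U in Set.Ico (0 : ℝ) 1, {U | (network p U).Adj i j}.indicator (fun _ => (1 : ℝ)) U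

lemma integrableOn_adj {n : ℕ} (p : Fin n → ℝ) (i j : Fin n) :
    IntegrableOn ({U | (network p U).Adj i j}.indicator fun _ => (1 : ℝ)) (Set.Ico (0 : ℝ) 1) :=
  Integrable.indicator (integrable_const _) (measurableSet_network_adj p i j)

lemma adjProb_comm {n : ℕ} (p : Fin n → ℝ) (i j : Fin n) : adjProb p i j = adjProb p j i := by
  simp only [adjProb, SimpleGraph.adj_comm]

/-- A single point of segment `i`, its left end point, already suffices: the event that its double
lands in segment `j` has probability exactly `p j`. -/
lemma le_adjProb {n : ℕ} {p : Fin n → ℝ} (hp : ∀ i, 0 < p i) (hsum : ∑ i, p i = 1)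
    {i j : Fin n} (hij : i ≠ j) : p j ≤ adjProb p i j := by
  have h := setIntegral_indicator_fract_add (cdfBefore_nonneg hp j)
    (by linarith [hp j] : cdfBefore p j ≤ cdfBefore p j + p j)
    (hsum ▸ cdfBefore_add_le_sum hp j) (2 * cdfBefore p i)
  rw [add_sub_cancel_left] at h
  rw [← h]
  refine integral_mono_of_nonneg (ae_of_all _ fun U => ?_) (integrableOn_adj p i j)
    (ae_of_all _ fun U => ?_)
  · exact Set.indicator_nonneg (fun _ _ => zero_le_one) _
  · by_cases hU : Int.fract (U + 2 * cdfBefore p i) ∈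
        Set.Ico (cdfBefore p j) (cdfBefore p j + p j)
    · have hadj : U ∈ {U | (network p U).Adj i j} :=
        (network_adj_iff p U i j).2 ⟨hij, Or.inl (doublingEdge_of_fract_mem (hp i) hU)⟩
      simp only [Set.indicator_of_mem hU, Set.indicator_of_mem hadj, le_refl]
    · simp only [Set.indicator_of_notMem hU]
      exact Set.indicator_nonneg (fun _ _ => zero_le_one) _

lemma ncard_cut_eq_sum {n : ℕ} (p : Fin n → ℝ) (S : Finset (Fin n)) (U : ℝ) :
    ((cut (network p U) S).ncard : ℝ) =
      ∑ i ∈ S, ∑ j ∈ Sᶜ, {U | (network p U).Adj i j}.indicator (fun _ => (1 : ℝ)) U := by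
  classical
  have h : cut (network p U) S =
      ((S ×ˢ Sᶜ).filter fun e => (network p U).Adj e.1 e.2 : Finset (Fin n × Fin n)) := by
    ext e
    simp [cut, and_assoc]
  rw [h, Set.ncard_coe_finset, Finset.card_filter, Finset.sum_product]
  push_cast
  rfl

lemma expectedCut_eq_sum {n : ℕ} (p : Fin n → ℝ) (S : Finset (Fin n)) :
    expectedCut p S = ∑ i ∈ S, ∑ j ∈ Sᶜ, adjProb p i j := by
  simp only [expectedCut, ncard_cut_eq_sum]
  rw [integral_finsetSum _ fun i _ => integrable_finsetSum _ fun j _ => integrableOn_adj p i j]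
  refine Finset.sum_congr rfl fun i _ => ?_
  rw [integral_finsetSum _ fun j _ => integrableOn_adj p i j]
  rfl

lemma card_mul_sum_le_two_mul_expectedCut {n : ℕ} {p : Fin n → ℝ} (hp : ∀ i, 0 < p i)
    (hsum : ∑ i, p i = 1) {S : Finset (Fin n)} (hS : ∑ i ∈ S, p i ≤ 1 / 2) :
    n * ∑ i ∈ S, p i ≤ 2 * expectedCut p S := by
  have hne : ∀ i ∈ S, ∀ j ∈ Sᶜ, i ≠ j := fun i hi j hj hij =>
    Finset.mem_compl.1 hj (hij ▸ hi)
  have h₁ : (S.card : ℝ) * ∑ j ∈ Sᶜ, p j ≤ expectedCut p S := by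
    rw [expectedCut_eq_sum, ← nsmul_eq_mul, ← Finset.sum_const]
    exact Finset.sum_le_sum fun i hi => Finset.sum_le_sum fun j hj =>
      le_adjProb hp hsum (hne i hi j hj)
  have h₂ : (Sᶜ.card : ℝ) * ∑ i ∈ S, p i ≤ expectedCut p S := by
    rw [expectedCut_eq_sum, Finset.mul_sum]
    refine Finset.sum_le_sum fun i hi => ?_
    rw [← nsmul_eq_mul, ← Finset.sum_const]
    -- Here the pair is reversed, so that the lower bound is the mass of the end point in `S`.
    exact Finset.sum_le_sum fun j hj =>
      adjProb_comm p i j ▸ le_adjProb hp hsum (hne i hi j hj).symm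
  have hcard : (S.card : ℝ) + Sᶜ.card = n := by
    exact_mod_cast (Finset.card_add_card_compl S).trans (Fintype.card_fin n)
  have hcompl := Finset.sum_add_sum_compl S p
  -- The only use of `hS`: the mass of `S` is at most that of `Sᶜ`.
  have h₃ : (S.card : ℝ) * ∑ i ∈ S, p i ≤ S.card * ∑ j ∈ Sᶜ, p j :=
    mul_le_mul_of_nonneg_left (by linarith) (Nat.cast_nonneg _)
  rw [← hcard, add_mul]
  linarith

/-- The minimum is at most the average `1 / n ≤ 1 / 2`. -/
lemma one_le_logb_one_div_pMin {n : ℕ} (hn : 2 ≤ n) {p : Fin n → ℝ} (hp : ∀ i, 0 < p i)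
    (hsum : ∑ i, p i = 1) : 1 ≤ Real.logb 2 (1 / pMin p) := by
  have : Nonempty (Fin n) := ⟨⟨0, by omega⟩⟩
  have hle : ∀ i, pMin p ≤ p i := ciInf_le (Set.finite_range p).bddBelow
  have hpos : 0 < pMin p := by
    obtain ⟨i, hi⟩ := exists_eq_ciInf_of_finite (f := p)
    exact (hp i).trans_eq hi
  have hmul : (n : ℝ) * pMin p ≤ 1 := by
    rw [← hsum]
    simpa using Finset.card_nsmul_le_sum Finset.univ p (pMin p) fun i _ => hle i
  have htwo : 2 * pMin p ≤ n * pMin p :=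
    mul_le_mul_of_nonneg_right (by exact_mod_cast hn) hpos.le
  rw [Real.le_logb_iff_rpow_le one_lt_two (by positivity), Real.rpow_one, le_div_iff₀ hpos]
  linarith

lemma IsActivity.sum_eq_one {n : ℕ} {R : Matrix (Fin n) (Fin n) ℝ} {p : Fin n → ℝ}
    (hp : IsActivity R p) (hR : IsDemandMatrix R) : ∑ i, p i = 1 := by
  rcases hp with ⟨rfl, -⟩ | ⟨rfl, -⟩
  · exact hR.sum_eq_one
  · exact Finset.sum_comm.trans hR.sum_eq_one

end CACD

theorem mainTheorem2 :
    ∃ c : ℝ, 0 < c ∧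
      ∀ (n : ℕ) (_ : 2 ≤ n)
        (R : Matrix (Fin n) (Fin n) ℝ) (_ : CACD.IsDemandMatrix R)
        (p : Fin n → ℝ) (_ : CACD.IsActivity R p) (_ : ∀ i, 0 < p i)
        (S : Finset (Fin n)) (_ : ∑ i ∈ S, p i ≤ 1 / 2),
        c * (n * (∑ i ∈ S, p i) / Real.logb 2 (1 / CACD.pMin p)) ≤ CACD.expectedCut p S := by
  refine ⟨1 / 2, by norm_num, fun n hn R hR p hact hp S hS => ?_⟩
  have hsum := hact.sum_eq_one hR
  have hcut := CACD.card_mul_sum_le_two_mul_expectedCut hp hsum hS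
  -- Dividing by a logarithm that is at least 1 only weakens the bound.
  have hlog := div_le_self (mul_nonneg (Nat.cast_nonneg n) (Finset.sum_nonneg fun i _ => (hp i).le))
    (CACD.one_le_logb_one_div_pMin hn hp hsum) (a := n * ∑ i ∈ S, p i)
  linarith
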